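/- Let $p > 1$ be an integer and let $A$ be a real $n \times n$ matrix. Define the ascent sequence $d_1, d_2, \dots$ of $A$ by $d_i = \dim \operatorname{null}(A^i) - \dim \operatorname{null}(A^{i-1})$ for $i \ge 1$. Then there is a real $n \times n$ matrix $X$ with $X^p = A$ if and only if both of the following hold: (i) for every integer $\nu \ge 0$ there is at most one index $i \ge 1$ with $p\nu < d_i < p(\nu+1)$; (ii) if $p$ is even, then for every negative eigenvalue $\lambda$ of $A$ and every integer $k \ge 1$, the number of $k \times k$ Jordan blocks with eigenvalue $\lambda$ in the Jordan canonical form of $A$ is even. -/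

import Mathlib

/-- The `k × k` Jordan block with eigenvalue `μ`: the entries on the diagonal are `μ`, those on the
first superdiagonal are `1`, and all others are `0`. -/
def jordanBlock {K : Type*} [Field K] (k : ℕ) (μ : K) : Matrix (Fin k) (Fin k) K :=
  Matrix.of fun i j => if i = j then μ else if (i : ℕ) + 1 = (j : ℕ) then 1 else 0

/-- A Jordan canonical form of a square matrix `A` over `K`: an invertible `Z` such that `Z⁻¹ A Z`
is the direct sum of finitely many Jordan blocks of positive sizes. The rows and columns of the
direct sum are naturally indexed by pairs (block, position in the block); `e` is the
identification of `Fin n` with these pairs. -/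
structure JordanForm {K : Type*} [Field K] {n : ℕ} (A : Matrix (Fin n) (Fin n) K) where
  /-- the number of Jordan blocks -/
  t : ℕ
  /-- the sizes of the blocks -/
  size : Fin t → ℕ
  size_pos : ∀ i, 0 < size i
  /-- the eigenvalues of the blocks -/
  eig : Fin t → K
  /-- the transforming matrix -/
  Z : Matrix.GeneralLinearGroup (Fin n) K
  e : (Σ i : Fin t, Fin (size i)) ≃ Fin n
  similar : (↑Z⁻¹ : Matrix (Fin n) (Fin n) K) * A * (↑Z : Matrix (Fin n) (Fin n) K) =
    Matrix.reindex e e (Matrix.blockDiagonal' fun i => jordanBlock (size i) (eig i))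

/-- The number of Jordan blocks of size `k` with eigenvalue `μ` in a Jordan canonical form. -/
noncomputable def JordanForm.numBlocks {K : Type*} [Field K] {n : ℕ} {A : Matrix (Fin n) (Fin n) K}
    (J : JordanForm A) (μ : K) (k : ℕ) : ℕ :=
  Nat.card {i : Fin J.t // J.eig i = μ ∧ J.size i = k}

/-- The dimension of the null space of a square matrix. -/
noncomputable def nullity {K : Type*} [Field K] {n : ℕ} (A : Matrix (Fin n) (Fin n) K) : ℕ :=
  Module.finrank K (LinearMap.ker (Matrix.toLin' A))

/-- The ascent sequence `d_i = dim null (A ^ i) - dim null (A ^ (i - 1))`, meant for `i ≥ 1`. -/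
noncomputable def ascentSeq {K : Type*} [Field K] {n : ℕ} (A : Matrix (Fin n) (Fin n) K)
    (i : ℕ) : ℤ :=
  (nullity (A ^ i) : ℤ) - (nullity (A ^ (i - 1)) : ℤ)

/-- For every integer `ν ≥ 0`, no more than one term of the sequence `d_1, d_2, …` (terms being
counted by their index) lies strictly between `p ν` and `p (ν + 1)`. -/
def AscentCondition {K : Type*} [Field K] {n : ℕ} (p : ℕ) (A : Matrix (Fin n) (Fin n) K) : Prop :=
  ∀ ν : ℕ, Set.Subsingleton
    {i : ℕ | 1 ≤ i ∧ (p : ℤ) * ν < ascentSeq A i ∧ ascentSeq A i < (p : ℤ) * (ν + 1)}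

/-- Every negative eigenvalue of the real matrix `A` has an even number of Jordan blocks of each
size in the (complex) Jordan canonical form of `A`. The form is unique up to the order of its
blocks, so it does not matter which one is taken. -/
def EvenNegativeBlocks {n : ℕ} (A : Matrix (Fin n) (Fin n) ℝ) : Prop :=
  ∃ J : JordanForm (A.map Complex.ofReal),
    ∀ μ : ℝ, μ < 0 → Module.End.HasEigenvalue (Matrix.toLin' A) μ →
      ∀ k : ℕ, Even (J.numBlocks (μ : ℂ) k)

/-!
An endomorphism `f` of a finite-dimensional space over a field `K` turns the space into a torsion
`K[X]`-module, so `f` is conjugate to multiplication by the family of roots on a finite product of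
rings `K[X] / (q i ^ e i)`, with `q i` monic irreducible and `e i > 0`
(`exists_equiv_pi_adjoinRoot`). Both conditions of the theorem are read off from this
decomposition through the identity
`dim ker (f - a) ^ k = ∑ min k (e i)`, the sum running over the `i` with `q i = X - a`
(`finrank_ker_sub_pow`). In particular `d k` is the number of factors with `q i = X` and `k ≤ e i`.
A Jordan form is such a decomposition with all `q i` linear, so the same identity holds for its
blocks, and since nullities do not change from `ℝ` to `ℂ`, the evenness condition says that
`dim ker (A - μ) ^ k` is even for all `μ < 0` and all `k`.

*Necessity.* Let `A = B ^ p`, and let `c` be the ascent sequence of `B`. It is antitone, and `d i`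
is the sum of the `i`-th group of `p` consecutive terms of `c`. If `d i < p (ν + 1)` then the last
term of that group is at most `ν`, so all later groups have sum at most `p ν`; hence no two of
the `d i` can lie strictly between `p ν` and `p (ν + 1)` (`ascentCondition_pow`). If `p = 2 r` is
even and `μ < 0`, the space `W = ker (A - μ) ^ k` is invariant under `B ^ r`, and
`det (B ^ r | W) ^ 2 = det (A | W) = μ ^ dim W`; so `dim W` is even (`even_finrank_ker_sub_pow`).

*Sufficiency.* The factors are grouped so that each group has a root of its own.
* If `q ≠ X`, and not both `p` is even and `q = X - a` with `a < 0`, the residue field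
  `ℝ[X] / (q)`, which is `ℝ` or `ℂ`, contains a `p`-th root of the class of `X`, and Newton's method
  lifts it to `ℝ[X] / (q ^ e)` (`exists_pow_eq_root_pow`).
* If `a < 0` and `p` is even, the factors `R = ℝ[X] / ((X - a) ^ k)` occur an even number of times.
  Newton's method gives `s` in `R` with `s ^ p = -X`, and the complex `p`-th root of `-1`, seen as a
  real `2 × 2` matrix, gives a matrix `M` with `M ^ p = -1`; then `(s M) ^ p = X`
  (`exists_pow_eq_mulLeft_neg`).
* The nilpotent factors `K[X] / (X ^ e l)`, with `e` sorted in decreasing order, are spaces of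
  functions on `{(l, i) | i < e l}`, on which `X` acts by precomposition with
  `(l, i) ↦ (l, i + 1)`. This map is the `p`-th iterate of the one that walks through the indices `l`
  in groups of `p` and raises `i` on passing from the end of a group back to its start
  (`stairStep`). That map respects the diagram as soon as the sizes within a group differ by at
  most `1`, which is what the ascent condition says (`exists_pow_eq_mulLeft_nilpotent`).
-/

section

open Polynomial

/-! ### Transfer of roots of endomorphisms -/

/-- Having a `p`-th root is invariant under conjugation by a linear equivalence. -/
theorem exists_pow_eq_of_equiv {K V W : Type*} [Field K] [AddCommGroup V] [Module K V]
    [AddCommGroup W] [Module K W] {p : ℕ} {f : Module.End K V} {g : Module.End K W}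
    (Φ : V ≃ₗ[K] W) (h : ∀ v, Φ (f v) = g (Φ v)) (hg : ∃ y, y ^ p = g) : ∃ y, y ^ p = f := by
  obtain ⟨y, rfl⟩ := hg
  refine ⟨Φ.symm.conjAlgEquiv K y, ?_⟩
  rw [← map_pow]
  ext v
  apply Φ.injective
  simp [h, LinearEquiv.conjAlgEquiv_apply]

theorem exists_pow_eq_pi {K ι : Type*} [Field K] {V : ι → Type*} [∀ i, AddCommGroup (V i)]
    [∀ i, Module K (V i)] {p : ℕ} (f : ∀ i, Module.End K (V i)) (h : ∀ i, ∃ y, y ^ p = f i) :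
    ∃ y : Module.End K (∀ i, V i), ∀ v i, (y ^ p) v i = f i (v i) := by
  choose y hy using h
  refine ⟨LinearMap.pi fun i => y i ∘ₗ LinearMap.proj i, fun v i => ?_⟩
  rw [← hy]
  have : ∀ k : ℕ, ((LinearMap.pi fun i => y i ∘ₗ LinearMap.proj i) ^ k :
      Module.End K (∀ i, V i)) v i = (y i ^ k) (v i) := by
    intro k
    induction k with
    | zero => simp
    | succ k ih => rw [pow_succ', pow_succ', Module.End.mul_apply, Module.End.mul_apply, ← ih]; rfl
  exact this p

/-- Multiplication by `x` on a product of algebras has a `p`-th root if it has one on the product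
over each fibre of a map `c` on the index set. -/
theorem exists_pow_eq_mulLeft_of_fibers {K ι γ : Type*} [Field K] {M : ι → Type*}
    [∀ i, CommRing (M i)] [∀ i, Algebra K (M i)] {p : ℕ} (c : ι → γ) (x : ∀ i, M i)
    (h : ∀ g, ∃ y : Module.End K (∀ i : {i // c i = g}, M i),
      y ^ p = LinearMap.mulLeft K (fun i : {i // c i = g} => x i)) :
    ∃ y : Module.End K (∀ i, M i), y ^ p = LinearMap.mulLeft K x := by
  let E : (∀ i, M i) ≃ₗ[K] ∀ g, ∀ i : {i // c i = g}, M i :=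
    { toFun := fun v g i => v i
      map_add' := fun _ _ => rfl
      map_smul' := fun _ _ => rfl
      invFun := fun w i => w (c i) ⟨i, rfl⟩
      left_inv := fun _ => rfl
      right_inv := fun w => by
        funext g ⟨i, hi⟩
        subst hi
        rfl }
  obtain ⟨y, hy⟩ := exists_pow_eq_pi _ h
  refine exists_pow_eq_of_equiv (g := y ^ p) E (fun v => ?_) ⟨y, rfl⟩
  funext g
  rw [hy]
  rfl

/-- If `V` embeds into `U` as a subspace invariant under `y`, and `y ^ p` extends `f`, then the
restriction of `y` is a `p`-th root of `f`. -/
theorem exists_pow_eq_of_injective {K V U : Type*} [Field K] [AddCommGroup V] [Module K V]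
    [AddCommGroup U] [Module K U] {p : ℕ} {f : Module.End K V} (T : V →ₗ[K] U)
    (hT : Function.Injective T) (y : Module.End K U) (hy : ∀ v, (y ^ p) (T v) = T (f v))
    (hr : ∀ v, y (T v) ∈ LinearMap.range T) : ∃ z, z ^ p = f := by
  have hr' : ∀ u ∈ LinearMap.range T, y u ∈ LinearMap.range T := by
    rintro _ ⟨v, rfl⟩
    exact hr v
  refine exists_pow_eq_of_equiv (g := y.restrict hr' ^ p) (LinearEquiv.ofInjective T hT)
    (fun v => ?_) ⟨_, rfl⟩
  rw [Module.End.pow_restrict]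
  ext
  simp [hy]

/-! ### The primary decomposition of an endomorphism -/

/-- The structure theorem for torsion modules over `K[X]`, applied to the module defined by `f`. -/
theorem exists_equiv_pi_adjoinRoot_of_irreducible {K V : Type} [Field K] [AddCommGroup V]
    [Module K V] [FiniteDimensional K V] (f : Module.End K V) :
    ∃ (ι : Type) (_ : Fintype ι) (q : ι → K[X]) (e : ι → ℕ)
      (Φ : V ≃ₗ[K] ∀ i, AdjoinRoot (q i ^ e i)), (∀ i, Irreducible (q i)) ∧
      ∀ v, Φ (f v) = LinearMap.mulLeft K (fun i => AdjoinRoot.root (q i ^ e i)) (Φ v) := by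
  classical
  have htor : Module.IsTorsion K[X] (Module.AEval' f) :=
    Module.AEval.isTorsion_of_finiteDimensional K V f
  obtain ⟨ι, _, q, hq, e, ⟨Ψ⟩⟩ := Module.equiv_directSum_of_isTorsion htor
  let Ψ' := Ψ.trans (DirectSum.linearEquivFunOnFintype K[X] ι
    fun i => K[X] ⧸ Submodule.span K[X] {q i ^ e i})
  let Φ : V ≃ₗ[K] ∀ i, AdjoinRoot (q i ^ e i) :=
    { toFun := fun v => Ψ' (Module.AEval'.of f v)
      map_add' := fun v w => by
        rw [map_add, map_add]; rfl
      map_smul' := fun a v => by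
        rw [map_smul, ← Module.AEval.C_smul, map_smul]
        funext i
        simp only [RingHom.id_apply, Pi.smul_apply]
        obtain ⟨g, hg⟩ := Submodule.Quotient.mk_surjective _ (Ψ' (Module.AEval'.of f v) i)
        change C a • Ψ' (Module.AEval'.of f v) i
          = a • (Ψ' (Module.AEval'.of f v) i : AdjoinRoot (q i ^ e i))
        rw [← hg]
        change AdjoinRoot.mk _ (C a * g) = a • AdjoinRoot.mk _ g
        rw [map_mul, Algebra.smul_def]
        rfl
      invFun := fun w => (Module.AEval'.of f).symm (Ψ'.symm w)
      left_inv := fun v => by simp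
      right_inv := fun w => by
        exact (congrArg Ψ' (LinearEquiv.apply_symm_apply _ _)).trans (Ψ'.apply_symm_apply w) }
  refine ⟨ι, inferInstance, q, e, Φ, hq, fun v => ?_⟩
  funext i
  change Ψ' (Module.AEval'.of f (f v)) i = AdjoinRoot.root _ * (Φ v i)
  rw [← Module.AEval'.X_smul_of, map_smul]
  obtain ⟨g, hg⟩ := Submodule.Quotient.mk_surjective _ (Ψ' (Module.AEval'.of f v) i)
  have hg' : Φ v i = AdjoinRoot.mk _ g := hg.symm
  rw [Pi.smul_apply, ← hg, hg']
  change AdjoinRoot.mk _ (X * g) = _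
  rw [map_mul]
  rfl

/-- The primary decomposition of `f`, with monic primes and without trivial factors. -/
theorem exists_equiv_pi_adjoinRoot {K V : Type} [Field K] [AddCommGroup V]
    [Module K V] [FiniteDimensional K V] (f : Module.End K V) :
    ∃ (ι : Type) (_ : Fintype ι) (q : ι → K[X]) (e : ι → ℕ)
      (Φ : V ≃ₗ[K] ∀ i, AdjoinRoot (q i ^ e i)), (∀ i, Irreducible (q i)) ∧ (∀ i, (q i).Monic) ∧
      (∀ i, 0 < e i) ∧
      ∀ v, Φ (f v) = LinearMap.mulLeft K (fun i => AdjoinRoot.root (q i ^ e i)) (Φ v) := by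
  classical
  obtain ⟨ι, _, q, e, Φ, hq, hΦ⟩ := exists_equiv_pi_adjoinRoot_of_irreducible f
  have ha : ∀ i, Associated (q i ^ e i) (normalize (q i) ^ e i) := fun i =>
    (normalize_associated (q i)).symm.pow_pow
  let T : (∀ i, AdjoinRoot (q i ^ e i)) →ₗ[K]
      ∀ i : {i // 0 < e i}, AdjoinRoot (normalize (q i) ^ e i) :=
    LinearMap.pi fun i => (AdjoinRoot.algEquivOfAssociated K _ _ (ha i)).toLinearMap ∘ₗ
      LinearMap.proj i.1
  have hT : Function.Bijective T := by
    constructor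
    · intro v w h
      funext i
      rcases Nat.eq_zero_or_pos (e i) with h0 | h0
      · have : Subsingleton (AdjoinRoot (q i ^ e i)) := by
          refine subsingleton_of_zero_eq_one ?_
          rw [← map_one (AdjoinRoot.mk _), eq_comm, AdjoinRoot.mk_eq_zero, h0, pow_zero]
        exact Subsingleton.elim _ _
      · exact (AdjoinRoot.algEquivOfAssociated K _ _ (ha i)).injective (congrFun h ⟨i, h0⟩)
    · intro w
      refine ⟨fun i => if h0 : 0 < e i then
        (AdjoinRoot.algEquivOfAssociated K _ _ (ha i)).symm (w ⟨i, h0⟩) else 0, ?_⟩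
      funext ⟨i, h0⟩
      simp [T, h0, -AdjoinRoot.algEquivOfAssociated_symm]
  refine ⟨{i // 0 < e i}, inferInstance, fun i => normalize (q i), fun i => e i,
    Φ.trans (LinearEquiv.ofBijective T hT), fun i => ?_, fun i => ?_, fun i => i.2, fun v => ?_⟩
  · exact (normalize_associated (q i)).irreducible_iff.2 (hq i)
  · exact monic_normalize (hq i).ne_zero
  · funext i
    simp [hΦ, T, -AdjoinRoot.algEquivOfAssociated_symm]

/-! ### Jordan blocks and the dimensions of null spaces -/

theorem jordanBlock_mulVec_apply {K : Type*} [Field K] (k : ℕ) (μ : K) (c : Fin k → K)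
    (j : Fin k) : (jordanBlock k μ).mulVec c j =
      μ * c j + if h : (j : ℕ) + 1 < k then c ⟨j + 1, h⟩ else 0 := by
  have h1 : ∀ i, jordanBlock k μ j i * c i =
      (if j = i then μ * c i else 0) + (if (j : ℕ) + 1 = i then c i else 0) := by
    intro i
    simp only [jordanBlock, Matrix.of_apply]
    by_cases h : j = i
    · subst h; simp
    · simp [h]
  simp only [Matrix.mulVec, dotProduct, h1, Finset.sum_add_distrib, Finset.sum_ite_eq,
    Finset.mem_univ, if_true]
  congr 1
  split_ifs with h
  · rw [Finset.sum_eq_single ⟨j + 1, h⟩] <;> simp +contextual [Fin.ext_iff, eq_comm]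
  · exact Finset.sum_eq_zero fun i _ => if_neg fun hi : (j : ℕ) + 1 = i => h (by omega)

/-- The Jordan block is the matrix of multiplication by `X` on `K[X] / ((X - μ) ^ e)` with respect to
the basis of powers of `X - μ`, in decreasing order of the exponents. -/
theorem exists_equiv_jordanBlock {K : Type*} [Field K] (μ : K) (e : ℕ) :
    ∃ φ : (Fin e → K) ≃ₗ[K] AdjoinRoot ((X - C μ) ^ e),
      ∀ c, φ ((jordanBlock e μ).mulVec c) = AdjoinRoot.root _ * φ c := by
  set P : K[X] := (X - C μ) ^ e with hP
  have hPm : P.Monic := (monic_X_sub_C μ).pow e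
  set y : AdjoinRoot P := AdjoinRoot.mk P (X - C μ) with hy
  have hroot : AdjoinRoot.root P = algebraMap K _ μ + y := by
    rw [hy, map_sub, AdjoinRoot.mk_X, AdjoinRoot.mk_C, AdjoinRoot.algebraMap_eq]; ring
  have hye : ∀ k, e ≤ k → y ^ k = 0 := by
    intro k hk
    rw [hy, ← map_pow, AdjoinRoot.mk_eq_zero]
    exact pow_dvd_pow _ hk
  let ψ : (Fin e → K) →ₗ[K] AdjoinRoot P :=
    Fintype.linearCombination K fun j : Fin e => y ^ (e - 1 - j)
  have hψ : ∀ c, ψ c = ∑ j, c j • y ^ (e - 1 - j : ℕ) := fun c => rfl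
  have hfin : Module.finrank K (AdjoinRoot P) = e := by
    rw [(AdjoinRoot.powerBasis' hPm).finrank]
    simp [hP]
  have hfd : FiniteDimensional K (AdjoinRoot P) := hPm.finite_adjoinRoot
  have hsurj : Function.Surjective ψ := by
    intro r
    obtain ⟨g, rfl⟩ := AdjoinRoot.mk_surjective r
    refine (LinearMap.mem_range (f := ψ)).1 ?_
    rw [← sum_taylor_eq g μ, Polynomial.sum, map_sum]
    refine Submodule.sum_mem _ fun k _ => ?_
    rw [map_mul, map_pow, ← hy]
    by_cases hk : k < e
    · refine ⟨Pi.single ⟨e - 1 - k, by omega⟩ ((taylor μ g).coeff k), ?_⟩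
      have : e - 1 - (e - 1 - k) = k := by omega
      rw [hψ, Finset.sum_eq_single ⟨e - 1 - k, by omega⟩]
      · simp [this, Algebra.smul_def, AdjoinRoot.algebraMap_eq]
      · intro b _ hb
        simp [hb]
      · simp
    · rw [hye k (by omega), mul_zero]
      exact zero_mem _
  have hbij : Function.Bijective ψ :=
    ⟨(LinearMap.injective_iff_surjective_of_finrank_eq_finrank (by simp [hfin])).2 hsurj, hsurj⟩
  refine ⟨LinearEquiv.ofBijective ψ hbij, fun c => ?_⟩
  simp only [LinearEquiv.ofBijective_apply]
  rw [hψ, hψ, hroot, add_mul, ← Algebra.smul_def, Finset.smul_sum]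
  simp only [jordanBlock_mulVec_apply, add_smul, Finset.sum_add_distrib, mul_smul]
  congr 1
  clear hψ hfin hsurj hbij
  clear_value y P
  cases e with
  | zero => simp
  | succ m =>
    rw [Fin.sum_univ_castSucc, Fin.sum_univ_succ, mul_add, Finset.mul_sum]
    have h1 : y * c 0 • y ^ (m + 1 - 1 - ((0 : Fin (m + 1)) : ℕ)) = 0 := by
      rw [mul_smul_comm, ← pow_succ', hye _ (by simp), smul_zero]
    rw [h1, zero_add]
    simp only [Fin.val_last, lt_irrefl, dite_false, zero_smul, add_zero]
    refine Finset.sum_congr rfl fun j _ => ?_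
    have h2 : (j.castSucc : ℕ) + 1 < m + 1 := by simp
    rw [dif_pos h2, mul_smul_comm, ← pow_succ']
    congr 2
    simp only [Fin.val_castSucc, Fin.val_succ]
    omega

theorem finrank_ker_mulLeft_pi {K ι : Type*} [Field K] [Fintype ι] {M : ι → Type*}
    [∀ i, CommRing (M i)] [∀ i, Algebra K (M i)] [∀ i, FiniteDimensional K (M i)] (x : ∀ i, M i) :
    Module.finrank K (LinearMap.ker (LinearMap.mulLeft K x)) =
      ∑ i, Module.finrank K (LinearMap.ker (LinearMap.mulLeft K (x i))) := by
  rw [← Module.finrank_pi_fintype]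
  refine LinearEquiv.finrank_eq
    { toFun := fun v i => ⟨v.1 i, congrFun (LinearMap.mem_ker.1 v.2) i⟩
      map_add' := fun _ _ => rfl
      map_smul' := fun _ _ => rfl
      invFun := fun w => ⟨fun i => w i, LinearMap.mem_ker.2 (funext fun i => (w i).2)⟩
      left_inv := fun _ => rfl
      right_inv := fun _ => rfl }

theorem finrank_ker_mulLeft_root_sub_pow_self {K : Type*} [Field K] (a : K) (e k : ℕ) :
    Module.finrank K (LinearMap.ker (LinearMap.mulLeft K
      ((AdjoinRoot.root ((X - C a) ^ e) - algebraMap K _ a) ^ k))) = min k e := by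
  obtain ⟨φ, hφ⟩ := exists_equiv_jordanBlock a e
  set x := AdjoinRoot.root ((X - C a) ^ e) with hx
  have h1 : ∀ k c j, φ.symm ((x - algebraMap K _ a) ^ k * φ c) j =
      if h : (j : ℕ) + k < e then c ⟨j + k, h⟩ else 0 := by
    intro k
    induction k with
    | zero => intro c j; simp
    | succ k ih =>
      intro c j
      have h2 : (x - algebraMap K _ a) * φ c = φ ((jordanBlock e a).mulVec c - a • c) := by
        rw [map_sub, hφ, map_smul, sub_mul, Algebra.smul_def]
      rw [pow_succ, mul_assoc, h2, ih]
      by_cases h3 : (j : ℕ) + k < e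
      · simp [h3, jordanBlock_mulVec_apply, add_assoc]
      · rw [dif_neg h3, dif_neg (by omega)]
  have h2 : ∀ c : Fin e → K, (x - algebraMap K _ a) ^ k * φ c = 0 ↔
      ∀ j : Fin e, k ≤ (j : ℕ) → c j = 0 := by
    intro c
    rw [← φ.symm.map_eq_zero_iff, funext_iff]
    simp only [h1, Pi.zero_apply]
    constructor
    · intro h j hj
      have := h ⟨j - k, by omega⟩
      rw [dif_pos (show (j : ℕ) - k + k < e by omega)] at this
      convert this using 2
      ext
      simp
      omega
    · intro h j
      split_ifs with h3
      · exact h _ (by simp)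
      · rfl
  let T : LinearMap.ker (LinearMap.mulLeft K ((x - algebraMap K _ a) ^ k)) →ₗ[K]
      ({j : Fin e // (j : ℕ) < k} → K) :=
    LinearMap.pi fun j => LinearMap.proj j.1 ∘ₗ φ.symm.toLinearMap ∘ₗ Submodule.subtype _
  have hTc : ∀ c hc j, T ⟨φ c, hc⟩ j = c j.1 := fun c _ j => congrFun (φ.symm_apply_apply c) j.1
  have hT : Function.Bijective T := by
    constructor
    · rw [injective_iff_map_eq_zero]
      rintro ⟨v, hv⟩ h
      obtain ⟨c, rfl⟩ := φ.surjective v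
      have hv' := (h2 c).1 hv
      have : c = 0 := by
        funext j
        by_cases hj : (j : ℕ) < k
        · have := congrFun h ⟨j, hj⟩
          rwa [hTc] at this
        · exact hv' j (by omega)
      simp only [this, map_zero]
      rfl
    · intro w
      refine ⟨⟨φ fun j => if h : (j : ℕ) < k then w ⟨j, h⟩ else 0, (h2 _).2 fun j hj => ?_⟩, ?_⟩
      · rw [dif_neg (by omega)]
      · funext ⟨j, hj⟩
        exact (hTc _ _ _).trans (dif_pos hj)
  rw [(LinearEquiv.ofBijective T hT).finrank_eq, Module.finrank_fintype_fun_eq_card,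
    Fintype.card_subtype, Fin.card_filter_val_lt, min_comm]

theorem finrank_ker_mulLeft_root_sub_pow_of_ne {K : Type*} [Field K] {q : K[X]}
    (hq : Irreducible q) (hm : q.Monic) (a : K) (h : q ≠ X - C a) (e k : ℕ) :
    Module.finrank K (LinearMap.ker (LinearMap.mulLeft K
      ((AdjoinRoot.root (q ^ e) - algebraMap K _ a) ^ k))) = 0 := by
  have hc : IsCoprime (q ^ e) (X - C a) := by
    refine IsCoprime.pow_left ((hq.coprime_iff_not_dvd).2 fun hd => h ?_)
    exact eq_of_monic_of_associated hm (monic_X_sub_C a)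
      (hq.associated_of_dvd (irreducible_X_sub_C a) hd)
  obtain ⟨u, v, huv⟩ := hc
  have hu : IsUnit (AdjoinRoot.root (q ^ e) - algebraMap K _ a) := by
    refine IsUnit.of_mul_eq_one (AdjoinRoot.mk _ v) ?_
    have := congrArg (AdjoinRoot.mk (q ^ e)) huv
    rw [map_add, map_mul, map_mul, AdjoinRoot.mk_self, mul_zero, zero_add, map_sub,
      AdjoinRoot.mk_X, AdjoinRoot.mk_C, map_one, mul_comm] at this
    exact this
  have : LinearMap.ker (LinearMap.mulLeft K
      ((AdjoinRoot.root (q ^ e) - algebraMap K _ a) ^ k)) = ⊥ := by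
    rw [LinearMap.ker_eq_bot']
    intro m hm
    exact (hu.pow k).mul_right_eq_zero.1 hm
  rw [this, finrank_bot]

/-- The dimensions of the generalized null spaces in terms of the primary decomposition. -/
theorem finrank_ker_sub_pow {K V ι : Type*} [Field K] [DecidableEq K] [AddCommGroup V] [Module K V]
    [Fintype ι] {f : Module.End K V} {q : ι → K[X]} {e : ι → ℕ}
    (hq : ∀ i, Irreducible (q i)) (hm : ∀ i, (q i).Monic)
    (Φ : V ≃ₗ[K] ∀ i, AdjoinRoot (q i ^ e i))
    (hΦ : ∀ v, Φ (f v) = LinearMap.mulLeft K (fun i => AdjoinRoot.root (q i ^ e i)) (Φ v))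
    (a : K) (k : ℕ) :
    Module.finrank K (LinearMap.ker ((f - algebraMap K _ a) ^ k)) =
      ∑ i with q i = X - C a, min k (e i) := by
  set x : ∀ i, AdjoinRoot (q i ^ e i) := fun i => AdjoinRoot.root (q i ^ e i) with hx
  have h1 : ∀ (k : ℕ) v, Φ (((f - algebraMap K _ a) ^ k) v) = (x - algebraMap K _ a) ^ k * Φ v := by
    intro k
    induction k with
    | zero => simp
    | succ k ih =>
      intro v
      have h2 : Φ ((f - algebraMap K _ a) v) = (x - algebraMap K _ a) * Φ v := by
        rw [LinearMap.sub_apply, map_sub, hΦ, sub_mul, Module.algebraMap_end_apply, map_smul,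
          Algebra.smul_def]
        rfl
      rw [pow_succ, Module.End.mul_apply, ih, h2, pow_succ, mul_assoc]
  have h2 : LinearMap.ker ((f - algebraMap K _ a) ^ k) =
      (LinearMap.ker (LinearMap.mulLeft K ((x - algebraMap K _ a) ^ k))).comap Φ.toLinearMap := by
    ext v
    rw [LinearMap.mem_ker, ← Φ.map_eq_zero_iff, h1]
    rfl
  have hfd : ∀ i, FiniteDimensional K (AdjoinRoot (q i ^ e i)) := fun i =>
    ((hm i).pow _).finite_adjoinRoot
  rw [h2, (Φ.ofSubmodule' _).finrank_eq, finrank_ker_mulLeft_pi, Finset.sum_filter]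
  refine Finset.sum_congr rfl fun i _ => ?_
  split_ifs with h
  · have h3 : ∀ q' : K[X], q' = X - C a → Module.finrank K (LinearMap.ker (LinearMap.mulLeft K
        ((AdjoinRoot.root (q' ^ e i) - algebraMap K _ a) ^ k))) = min k (e i) := by
      rintro _ rfl
      exact finrank_ker_mulLeft_root_sub_pow_self a (e i) k
    exact h3 _ h
  · exact finrank_ker_mulLeft_root_sub_pow_of_ne (hq i) (hm i) a h (e i) k

/-! ### Nullities of matrices -/

theorem Matrix.rank_eq_card_of_mul_mul_eq_diagonal {K m : Type*} [Field K] [Fintype m]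
    [DecidableEq m] [DecidableEq K] {V M U : Matrix m m K} {w : m → K} (hV : IsUnit V)
    (hU : IsUnit U) (h : V * M * U = Matrix.diagonal w) : M.rank = Fintype.card {i // w i ≠ 0} := by
  rw [← Matrix.rank_diagonal, ← h,
    Matrix.rank_mul_eq_left_of_isUnit_det _ _ ((Matrix.isUnit_iff_isUnit_det _).1 hU),
    Matrix.rank_mul_eq_right_of_isUnit_det _ _ ((Matrix.isUnit_iff_isUnit_det _).1 hV)]

/-- The rank of a square matrix does not change under extension of the field: the two-sided
reduction to a diagonal matrix maps to one over the larger field. -/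
theorem Matrix.rank_map_ringHom {K L m : Type*} [Field K] [Field L] [Fintype m] [DecidableEq m]
    (f : K →+* L) (M : Matrix m m K) : (M.map f).rank = M.rank := by
  classical
  obtain ⟨V, U, e, hV, hU, h⟩ := M.exists_rank_normal_form
  obtain ⟨w, hw⟩ : ∃ w : m → K, V * M * U = Matrix.diagonal w := by
    refine ⟨Sum.elim 1 0 ∘ e, ?_⟩
    rw [h, ← Matrix.submatrix_diagonal_equiv, ← Matrix.fromBlocks_diagonal]
    congr 2
    exact Matrix.diagonal_zero.symm
  have h2 : f.mapMatrix V * M.map f * f.mapMatrix U = Matrix.diagonal (f ∘ w) := by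
    rw [← RingHom.mapMatrix_apply, ← map_mul, ← map_mul, hw, RingHom.mapMatrix_apply,
      Matrix.diagonal_map (map_zero f)]
    rfl
  rw [Matrix.rank_eq_card_of_mul_mul_eq_diagonal hV hU hw,
    Matrix.rank_eq_card_of_mul_mul_eq_diagonal (hV.map f.mapMatrix) (hU.map f.mapMatrix) h2]
  exact Fintype.card_congr (Equiv.subtypeEquivRight fun i => by simp)

theorem nullity_add_rank {K : Type*} [Field K] {n : ℕ} (A : Matrix (Fin n) (Fin n) K) :
    nullity A + A.rank = n := by
  have := LinearMap.finrank_range_add_finrank_ker (Matrix.toLin' A)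
  rw [Module.finrank_fin_fun] at this
  rw [nullity, add_comm]
  exact this

theorem nullity_map {K L : Type*} [Field K] [Field L] {n : ℕ} (f : K →+* L)
    (A : Matrix (Fin n) (Fin n) K) : nullity (A.map f) = nullity A := by
  have h1 := nullity_add_rank A
  have h2 := nullity_add_rank (A.map f)
  rw [Matrix.rank_map_ringHom] at h2
  omega

theorem nullity_sub_scalar_pow {K : Type*} [Field K] {n : ℕ} (A : Matrix (Fin n) (Fin n) K)
    (a : K) (k : ℕ) : nullity ((A - Matrix.scalar _ a) ^ k) =
      Module.finrank K (LinearMap.ker ((Matrix.toLin' A - algebraMap K _ a) ^ k)) := by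
  have : Matrix.toLin' (Matrix.scalar (Fin n) a) = algebraMap K _ a := by
    ext
    simp [Pi.single_apply]
  rw [nullity, Matrix.toLin'_pow, map_sub, this]

theorem nullity_map_sub_scalar_pow {n : ℕ} (A : Matrix (Fin n) (Fin n) ℝ) (a : ℝ) (k : ℕ) :
    nullity ((A.map Complex.ofReal - Matrix.scalar _ (a : ℂ)) ^ k) =
      nullity ((A - Matrix.scalar _ a) ^ k) := by
  rw [← nullity_map Complex.ofRealHom ((A - Matrix.scalar _ a) ^ k), ← RingHom.mapMatrix_apply,
    map_pow, map_sub]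
  congr 3
  ext i j
  by_cases h : i = j <;> simp [h]

theorem nullity_pow_eq_sum {ι : Type*} {K : Type*} [Field K] [DecidableEq K] [Fintype ι] {n : ℕ}
    {A : Matrix (Fin n) (Fin n) K} {q : ι → K[X]} {e : ι → ℕ}
    (hq : ∀ i, Irreducible (q i)) (hm : ∀ i, (q i).Monic)
    (Φ : (Fin n → K) ≃ₗ[K] ∀ i, AdjoinRoot (q i ^ e i))
    (hΦ : ∀ v, Φ (Matrix.toLin' A v) =
      LinearMap.mulLeft K (fun i => AdjoinRoot.root (q i ^ e i)) (Φ v)) (k : ℕ) :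
    nullity (A ^ k) = ∑ i with q i = X, min k (e i) := by
  have h := nullity_sub_scalar_pow A 0 k
  rw [map_zero, sub_zero, finrank_ker_sub_pow hq hm Φ hΦ, C_0, sub_zero] at h
  exact h

/-! ### Jordan forms -/

theorem Matrix.blockDiagonal'_mulVec_apply {K ι : Type*} [CommRing K] [Fintype ι] [DecidableEq ι]
    {s : ι → ℕ} (D : ∀ i, Matrix (Fin (s i)) (Fin (s i)) K) (w : (Σ i, Fin (s i)) → K)
    (i : ι) (j : Fin (s i)) :
    (Matrix.blockDiagonal' D).mulVec w ⟨i, j⟩ = (D i).mulVec (fun j => w ⟨i, j⟩) j := by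
  simp only [Matrix.mulVec, dotProduct, Fintype.sum_sigma]
  rw [Finset.sum_eq_single i]
  · simp
  · intro b _ hb
    refine Finset.sum_eq_zero fun x _ => ?_
    rw [Matrix.blockDiagonal'_apply_ne _ _ _ hb.symm, zero_mul]
  · simp

/-- A direct sum of Jordan blocks is multiplication by the family of roots on the corresponding
product of quotients of `K[X]`. -/
theorem exists_equiv_sigma {K ι : Type*} [Field K] [Fintype ι] [DecidableEq ι] (s : ι → ℕ)
    (μ : ι → K) :
    ∃ φ : ((Σ i, Fin (s i)) → K) ≃ₗ[K] ∀ i, AdjoinRoot ((X - C (μ i)) ^ s i),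
      ∀ w, φ ((Matrix.blockDiagonal' fun i => jordanBlock (s i) (μ i)).mulVec w) =
        LinearMap.mulLeft K (fun i => AdjoinRoot.root ((X - C (μ i) : K[X]) ^ s i)) (φ w) := by
  choose φ hφ using fun i => exists_equiv_jordanBlock (μ i) (s i)
  refine ⟨(LinearEquiv.piCurry K fun i (_ : Fin (s i)) => K).trans (LinearEquiv.piCongrRight φ),
    fun w => ?_⟩
  funext i
  refine Eq.trans ?_ (hφ i _)
  change φ i _ = φ i _
  congr 1
  funext j
  exact Matrix.blockDiagonal'_mulVec_apply _ _ _ _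

/-- A Jordan form of `A` gives a primary decomposition with one linear prime for each block. -/
theorem JordanForm.exists_equiv {K : Type*} [Field K] {n : ℕ} {A : Matrix (Fin n) (Fin n) K}
    (J : JordanForm A) :
    ∃ Φ : (Fin n → K) ≃ₗ[K] ∀ i, AdjoinRoot ((X - C (J.eig i)) ^ J.size i),
      ∀ v, Φ (Matrix.toLin' A v) =
        LinearMap.mulLeft K
          (fun i => AdjoinRoot.root ((X - C (J.eig i) : K[X]) ^ J.size i)) (Φ v) := by
  obtain ⟨φ, hφ⟩ := exists_equiv_sigma J.size J.eig
  let W : (Fin n → K) ≃ₗ[K] (Fin n → K) := LinearEquiv.ofLinearMap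
    (Matrix.toLin' (↑J.Z⁻¹ : Matrix (Fin n) (Fin n) K)) (Matrix.toLin' J.Z)
    (by rw [← Matrix.toLin'_mul, Units.inv_mul, Matrix.toLin'_one])
    (by rw [← Matrix.toLin'_mul, Units.mul_inv, Matrix.toLin'_one])
  refine ⟨(W.trans (LinearEquiv.funCongrLeft K K J.e)).trans φ, fun v => ?_⟩
  simp only [LinearEquiv.trans_apply]
  rw [← hφ]
  congr 1
  have h1 : W (Matrix.toLin' A v) = (Matrix.reindex J.e J.e
      (Matrix.blockDiagonal' fun i => jordanBlock (J.size i) (J.eig i))).mulVec (W v) := by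
    rw [← J.similar]
    change (↑J.Z⁻¹ : Matrix (Fin n) (Fin n) K).mulVec (A.mulVec v) = Matrix.mulVec _
      ((↑J.Z⁻¹ : Matrix (Fin n) (Fin n) K).mulVec v)
    simp [Matrix.mulVec_mulVec, mul_assoc]
  rw [h1, Matrix.reindex_apply, Matrix.submatrix_mulVec_equiv]
  funext x
  simp [LinearEquiv.funCongrLeft, LinearMap.funLeft]

theorem JordanForm.nullity_sub_scalar_pow {K : Type*} [Field K] [DecidableEq K] {n : ℕ}
    {A : Matrix (Fin n) (Fin n) K} (J : JordanForm A) (a : K) (k : ℕ) :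
    nullity ((A - Matrix.scalar _ a) ^ k) = ∑ i with J.eig i = a, min k (J.size i) := by
  obtain ⟨Φ, hΦ⟩ := J.exists_equiv
  rw [_root_.nullity_sub_scalar_pow, finrank_ker_sub_pow (fun i => irreducible_X_sub_C _)
    (fun i => monic_X_sub_C _) Φ hΦ]
  refine Finset.sum_congr (Finset.filter_congr fun i _ => ?_) fun _ _ => rfl
  simp

theorem exists_jordanForm {n : ℕ} (A : Matrix (Fin n) (Fin n) ℂ) : Nonempty (JordanForm A) := by
  obtain ⟨ι, _, q, s, Φ, hq, hm, hs, hΦ⟩ := exists_equiv_pi_adjoinRoot (Matrix.toLin' A)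
  have hlin : ∀ i, ∃ μ : ℂ, q i = X - C μ := by
    intro i
    obtain ⟨μ, hμ⟩ := IsAlgClosed.exists_root (q i) (degree_pos_of_irreducible (hq i)).ne'
    exact ⟨μ, (eq_of_monic_of_associated (monic_X_sub_C μ) (hm i)
      ((irreducible_X_sub_C μ).associated_of_dvd (hq i) (dvd_iff_isRoot.2 hμ))).symm⟩
  choose μ hμ using hlin
  obtain rfl : q = fun i => X - C (μ i) := funext hμ
  let σ := (Fintype.equivFin ι).symm
  obtain ⟨φ, hφ⟩ := exists_equiv_sigma (s ∘ σ) (μ ∘ σ)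
  let Ψ : (Fin n → ℂ) ≃ₗ[ℂ] ((Σ i, Fin ((s ∘ σ) i)) → ℂ) := (Φ.trans
    (LinearEquiv.piCongrLeft' ℂ (fun i => AdjoinRoot ((X - C (μ i)) ^ s i)) σ.symm)).trans φ.symm
  have hΨ : ∀ v, Ψ (Matrix.toLin' A v) =
      (Matrix.blockDiagonal' fun i => jordanBlock ((s ∘ σ) i) ((μ ∘ σ) i)).mulVec (Ψ v) := by
    intro v
    apply φ.injective
    rw [hφ]
    simp only [Ψ, LinearEquiv.trans_apply, LinearEquiv.apply_symm_apply, hΦ]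
    rfl
  have hcard : Fintype.card (Σ i, Fin ((s ∘ σ) i)) = Fintype.card (Fin n) := by
    exact (Module.finrank_fintype_fun_eq_card ℂ).symm.trans
      (Ψ.finrank_eq.symm.trans (Module.finrank_fintype_fun_eq_card ℂ))
  let e := Fintype.equivOfCardEq hcard
  let W : (Fin n → ℂ) ≃ₗ[ℂ] (Fin n → ℂ) := Ψ.trans (LinearEquiv.funCongrLeft ℂ ℂ e.symm)
  let B := Matrix.reindex e e
      (Matrix.blockDiagonal' fun i => jordanBlock ((s ∘ σ) i) ((μ ∘ σ) i))
  have hW : ∀ v, W (Matrix.toLin' A v) = B.mulVec (W v) := by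
    intro v
    simp only [W, LinearEquiv.trans_apply, hΨ, B, Matrix.reindex_apply,
      Matrix.submatrix_mulVec_equiv]
    funext x
    simp [LinearEquiv.funCongrLeft, LinearMap.funLeft, Function.comp_def]
  exact ⟨{
    t := Fintype.card ι
    size := s ∘ σ
    size_pos := fun i => hs _
    eig := μ ∘ σ
    Z := ⟨LinearMap.toMatrix' W.symm.toLinearMap, LinearMap.toMatrix' W.toLinearMap,
      by rw [← LinearMap.toMatrix'_comp]; simp, by rw [← LinearMap.toMatrix'_comp]; simp⟩
    e := e
    similar := by
      change LinearMap.toMatrix' W.toLinearMap * A * LinearMap.toMatrix' W.symm.toLinearMap = B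
      apply Matrix.toLin'.injective
      refine LinearMap.ext fun v => ?_
      rw [Matrix.toLin'_mul, Matrix.toLin'_mul, Matrix.toLin'_toMatrix', Matrix.toLin'_toMatrix']
      have := hW (W.symm v)
      rw [LinearEquiv.apply_symm_apply] at this
      exact this }⟩

/-! ### Parity and counting of block sizes -/

theorem sum_min_succ {ι : Type*} (s : Finset ι) (e : ι → ℕ) (k : ℕ) :
    ∑ i ∈ s, min (k + 1) (e i) = ∑ i ∈ s, min k (e i) + (s.filter fun i => k + 1 ≤ e i).card := by
  rw [Finset.card_filter, ← Finset.sum_add_distrib]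
  refine Finset.sum_congr rfl fun i _ => ?_
  split_ifs <;> omega

theorem even_sum_min_of_even_card {ι : Type*} (s : Finset ι) (e : ι → ℕ)
    (h : ∀ k, Even (s.filter fun i => e i = k).card) (k : ℕ) : Even (∑ i ∈ s, min k (e i)) := by
  classical
  rw [← Finset.sum_fiberwise_of_maps_to (g := e) (t := s.image e)
    fun i hi => Finset.mem_image_of_mem e hi]
  refine Finset.even_sum _ fun b _ => ?_
  rw [Finset.sum_congr rfl fun i hi => by rw [(Finset.mem_filter.1 hi).2], Finset.sum_const,
    smul_eq_mul]
  exact (h b).mul_right _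

/-- The counts of the `i` with `k ≤ e i` are the differences of consecutive sums, and the counts of
the `i` with `e i = k` are the differences of those. -/
theorem even_card_of_even_sum_min {ι : Type*} (s : Finset ι) (e : ι → ℕ)
    (h : ∀ k, Even (∑ i ∈ s, min k (e i))) (k : ℕ) :
    Even (s.filter fun i => e i = k + 1).card := by
  classical
  have h1 : ∀ k, Even (s.filter fun i => k + 1 ≤ e i).card := fun k =>
    (Nat.even_add.1 (sum_min_succ s e k ▸ h (k + 1))).1 (h k)
  have h2 : (s.filter fun i => k + 1 ≤ e i).card =
      (s.filter fun i => k + 1 + 1 ≤ e i).card + (s.filter fun i => e i = k + 1).card := by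
    simp only [Finset.card_filter, ← Finset.sum_add_distrib]
    refine Finset.sum_congr rfl fun i _ => ?_
    split_ifs <;> omega
  exact (Nat.even_add.1 (h2 ▸ h1 k)).1 (h1 (k + 1))

/-! ### Necessity of the conditions -/

/-- The space `W = ker (g ^ p - μ) ^ k` is invariant under `g ^ (p / 2)`, and the square of the
determinant of `g ^ (p / 2)` on `W` is `μ ^ dim W`, where `μ < 0`. -/
theorem even_finrank_ker_sub_pow {V : Type*} [AddCommGroup V] [Module ℝ V] [FiniteDimensional ℝ V]
    (g : Module.End ℝ V) {p : ℕ} (hp : Even p) {μ : ℝ} (hμ : μ < 0) (k : ℕ) :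
    Even (Module.finrank ℝ (LinearMap.ker ((g ^ p - algebraMap ℝ _ μ) ^ k))) := by
  obtain ⟨r, rfl⟩ := hp
  set f := g ^ (r + r) with hf
  set W := LinearMap.ker ((f - algebraMap ℝ _ μ) ^ k) with hW
  have hinv : ∀ s : Module.End ℝ V, Commute s f → ∀ w ∈ W, s w ∈ W := by
    intro s hs w hw
    have hc : Commute ((f - algebraMap ℝ _ μ) ^ k) s :=
      ((hs.symm.sub_left (Algebra.commutes μ s)).pow_left k)
    rw [hW, LinearMap.mem_ker] at hw ⊢
    rw [← Module.End.mul_apply, hc.eq, Module.End.mul_apply, hw, map_zero]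
  have hgr : ∀ w ∈ W, (g ^ r) w ∈ W := hinv _ ((Commute.refl g).pow_pow r (r + r))
  let F : Module.End ℝ W := (g ^ r).restrict hgr * (g ^ r).restrict hgr
  have hF : ∀ w : W, ((F w : W) : V) = f w := by
    intro w
    rw [hf, pow_add]
    rfl
  have hnil : ∀ w : W, ((algebraMap ℝ _ μ - F) ^ k) w = 0 := by
    have h1 : ∀ (j : ℕ) (w : W), ((((algebraMap ℝ _ μ - F) ^ j) w : W) : V) =
        (-1 : ℝ) ^ j • ((f - algebraMap ℝ _ μ) ^ j) w := by
      intro j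
      induction j with
      | zero => intro w; simp
      | succ j ih =>
        intro w
        have h2 : (((algebraMap ℝ (Module.End ℝ W) μ - F) w : W) : V) =
            -((f - algebraMap ℝ _ μ) w) := by
          simp [hF]
        rw [pow_succ, pow_succ (f - _), Module.End.mul_apply, Module.End.mul_apply, ih, h2, map_neg,
          pow_succ, mul_neg_one, neg_smul, smul_neg]
    intro w
    have h3 : ((f - algebraMap ℝ _ μ) ^ k) (w : V) = 0 := w.2
    exact Subtype.ext ((h1 k w).trans (by rw [h3, smul_zero]; rfl))
  have hchar := (LinearMap.charpoly_eq_X_pow_iff (algebraMap ℝ _ μ - F)).2 fun w => ⟨k, hnil w⟩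
  have hdet := LinearMap.eval_charpoly (algebraMap ℝ _ μ - F) μ
  rw [hchar, sub_sub_cancel, eval_pow, eval_X, map_mul] at hdet
  by_contra hodd
  have := (Nat.not_even_iff_odd.1 hodd).pow_neg hμ
  rw [hdet] at this
  exact absurd this (not_lt.2 (mul_self_nonneg _))

/-- A sum of `m` consecutive terms of an antitone sequence `c` with partial sums `F` lies between
`m` times the term after the last and `m` times the first one. -/
theorem le_add_mul_of_antitone {F c : ℕ → ℕ} (hF : ∀ j, F (j + 1) = F j + c j) (hc : Antitone c)
    (j m : ℕ) : F j + m * c (j + m) ≤ F (j + m) ∧ F (j + m) ≤ F j + m * c j := by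
  induction m with
  | zero => simp
  | succ m ih =>
    have h1 := hF (j + m)
    have h2 : c (j + m + 1) ≤ c (j + m) := hc (by omega)
    have h3 : c (j + m) ≤ c j := hc (by omega)
    have h4 : m * c (j + m + 1) ≤ m * c (j + m) := Nat.mul_le_mul_left m h2
    rw [← add_assoc, h1, add_mul, add_mul, one_mul, one_mul]
    omega

theorem ascentCondition_pow {K : Type} [Field K] {n : ℕ} (B : Matrix (Fin n) (Fin n) K)
    (p : ℕ) : AscentCondition p (B ^ p) := by
  classical
  obtain ⟨ι, _, q, e, Φ, hq, hm, -, hΦ⟩ := exists_equiv_pi_adjoinRoot (Matrix.toLin' B)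
  set s : Finset ι := Finset.univ.filter fun i => q i = X with hs
  let F : ℕ → ℕ := fun j => ∑ i ∈ s, min j (e i)
  let c : ℕ → ℕ := fun j => (s.filter fun i => j + 1 ≤ e i).card
  have hF : ∀ j, F (j + 1) = F j + c j := fun j => sum_min_succ s e j
  have hc : Antitone c := fun a b hab => Finset.card_le_card
    (Finset.monotone_filter_right s fun i _ (hi : b + 1 ≤ e i) => (by omega : a + 1 ≤ e i))
  have hnull : ∀ i, nullity ((B ^ p) ^ i) = F (p * i) := fun i => by
    rw [← pow_mul, nullity_pow_eq_sum hq hm Φ hΦ]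
  have hd : ∀ i, ascentSeq (B ^ p) (i + 1) = (F (p * i + p) : ℤ) - F (p * i) := fun i => by
    rw [ascentSeq, hnull, hnull, Nat.add_sub_cancel, mul_add, mul_one]
  have key : ∀ ν i j : ℕ, i < j → ascentSeq (B ^ p) (i + 1) < (p : ℤ) * (ν + 1) →
      (p : ℤ) * ν < ascentSeq (B ^ p) (j + 1) → False := by
    intro ν i j hij h1 h2
    rw [hd] at h1 h2
    have h3 := (le_add_mul_of_antitone hF hc (p * i) p).1
    have h4 := (le_add_mul_of_antitone hF hc (p * j) p).2
    have h5 : c (p * j) ≤ c (p * i + p) := hc (by nlinarith)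
    have h6 : p * c (p * i + p) < p * (ν + 1) := by zify; zify at h3; linarith
    have h7 : c (p * i + p) < ν + 1 := Nat.lt_of_mul_lt_mul_left h6
    have h8 : p * c (p * j) ≤ p * ν := Nat.mul_le_mul_left p (by omega)
    zify at h4 h8
    linarith
  rintro ν i ⟨hi, hi1, hi2⟩ j ⟨hj, hj1, hj2⟩
  obtain ⟨i, rfl⟩ := Nat.exists_eq_add_of_le' hi
  obtain ⟨j, rfl⟩ := Nat.exists_eq_add_of_le' hj
  rcases lt_trichotomy i j with h | h | h
  · exact (key ν i j h hi2 hj1).elim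
  · rw [h]
  · exact (key ν j i h hj2 hi1).elim

theorem JordanForm.numBlocks_eq_card {K : Type*} [Field K] [DecidableEq K] {n : ℕ}
    {A : Matrix (Fin n) (Fin n) K} (J : JordanForm A) (μ : K) (k : ℕ) :
    J.numBlocks μ k =
      ((Finset.univ.filter fun i => J.eig i = μ).filter fun i => J.size i = k).card := by
  rw [JordanForm.numBlocks, Nat.card_eq_fintype_card, Fintype.card_subtype, Finset.filter_filter]

theorem evenNegativeBlocks_pow {n p : ℕ} (hp : Even p) (B : Matrix (Fin n) (Fin n) ℝ) :
    EvenNegativeBlocks (B ^ p) := by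
  classical
  obtain ⟨J⟩ := exists_jordanForm ((B ^ p).map Complex.ofReal)
  refine ⟨J, fun μ hμ _ k => ?_⟩
  rw [J.numBlocks_eq_card]
  cases k with
  | zero =>
    rw [Finset.filter_eq_empty_iff.2 fun i _ => (J.size_pos i).ne']
    simp
  | succ k =>
    refine even_card_of_even_sum_min _ _ (fun k => ?_) k
    rw [← J.nullity_sub_scalar_pow, nullity_map_sub_scalar_pow, nullity_sub_scalar_pow,
      Matrix.toLin'_pow]
    exact even_finrank_ker_sub_pow _ hp hμ k

/-- If `a` is not an eigenvalue, the nullity is `0`; otherwise it is counted by blocks. -/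
theorem EvenNegativeBlocks.even_nullity {n : ℕ} {A : Matrix (Fin n) (Fin n) ℝ}
    (h : EvenNegativeBlocks A) {a : ℝ} (ha : a < 0) (k : ℕ) :
    Even (nullity ((A - Matrix.scalar _ a) ^ k)) := by
  classical
  obtain ⟨J, hJ⟩ := h
  by_cases hev : Module.End.HasEigenvalue (Matrix.toLin' A) a
  · rw [← nullity_map_sub_scalar_pow, J.nullity_sub_scalar_pow]
    exact even_sum_min_of_even_card _ _ (fun k => J.numBlocks_eq_card (a : ℂ) k ▸ hJ a ha hev k) k
  · have h1 : LinearMap.ker (Matrix.toLin' A - algebraMap ℝ _ a) = ⊥ := by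
      simpa [Module.End.hasEigenvalue_iff, Module.End.eigenspace_def,
        Algebra.algebraMap_eq_smul_one] using hev
    have h2 : LinearMap.ker ((Matrix.toLin' A - algebraMap ℝ _ a) ^ k) = ⊥ := by
      rw [LinearMap.ker_eq_bot] at h1 ⊢
      rw [Module.End.coe_pow]
      exact h1.iterate k
    rw [nullity_sub_scalar_pow, h2, finrank_bot]
    simp

/-! ### Roots of invertible blocks -/

/-- Newton's method: an approximate `p`-th root of a unit, up to a nilpotent error, can be refined to
a `p`-th root. -/
theorem exists_pow_eq_of_isNilpotent_sub {R : Type*} [CommRing R] [Algebra ℚ R] {p : ℕ}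
    (hp : p ≠ 0) {x y : R} (hx : IsUnit x) (hy : IsNilpotent (y ^ p - x)) : ∃ z, z ^ p = x := by
  have h1 : IsUnit (y ^ p) := by
    rw [← sub_add_cancel (y ^ p) x]
    exact hy.isUnit_add_right_of_commute hx (Commute.all _ _)
  have h2 : IsUnit y := (isUnit_pow_iff hp).1 h1
  have h3 : IsUnit (p : R) := by
    have : IsUnit (algebraMap ℚ R p) := (IsUnit.mk0 _ (Nat.cast_ne_zero.2 hp)).map _
    simpa using this
  obtain ⟨z, ⟨-, hz⟩, -⟩ := existsUnique_nilpotent_sub_and_aeval_eq_zero (R := R) (S := R)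
    (P := X ^ p - C x) (x := y) (by simpa using hy)
    (by simpa [derivative_X_pow] using h3.mul (h2.pow (p - 1)))
  exact ⟨z, by simpa [sub_eq_zero] using hz⟩

/-- The field `ℝ[X] / (q)` is isomorphic to `ℝ` or to `ℂ`; in the first case `q` is linear. -/
theorem exists_pow_eq_root_of_irreducible {p : ℕ} (hp : p ≠ 0) {q : ℝ[X]} (hq : Irreducible q)
    (hm : q.Monic) (h : ∀ a : ℝ, q = X - C a → ∃ b : ℝ, b ^ p = a) :
    ∃ y, y ^ p = AdjoinRoot.root q := by
  have : Fact (Irreducible q) := ⟨hq⟩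
  have : Module.Finite ℝ (AdjoinRoot q) := hm.finite_adjoinRoot
  rcases Real.nonempty_algEquiv_or (AdjoinRoot q) with ⟨⟨φ⟩⟩ | ⟨⟨φ⟩⟩
  · have h0 : aeval (φ (AdjoinRoot.root q)) q = 0 := by
      rw [aeval_algHom_apply, AdjoinRoot.aeval_eq, AdjoinRoot.mk_self, map_zero]
    have hd : X - C (φ (AdjoinRoot.root q)) ∣ q := dvd_iff_isRoot.2 (by simpa using h0)
    obtain ⟨b, hb⟩ := h _ (eq_of_monic_of_associated hm (monic_X_sub_C _)
      ((irreducible_X_sub_C _).associated_of_dvd hq hd).symm)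
    exact ⟨φ.symm b, φ.injective (by simp [hb])⟩
  · obtain ⟨z, hz⟩ := IsAlgClosed.exists_pow_nat_eq (φ (AdjoinRoot.root q)) (Nat.pos_of_ne_zero hp)
    exact ⟨φ.symm z, φ.injective (by simp [hz])⟩

theorem isUnit_root_pow {K : Type*} [Field K] {q : K[X]} (hq : Irreducible q) (hm : q.Monic)
    (hX : q ≠ X) (e : ℕ) : IsUnit (AdjoinRoot.root (q ^ e)) := by
  have hc : IsCoprime (q ^ e) X := by
    refine IsCoprime.pow_left ((hq.coprime_iff_not_dvd).2 fun hd => hX ?_)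
    exact eq_of_monic_of_associated hm monic_X (hq.associated_of_dvd irreducible_X hd)
  obtain ⟨u, v, huv⟩ := hc
  refine IsUnit.of_mul_eq_one (AdjoinRoot.mk _ v) ?_
  have := congrArg (AdjoinRoot.mk (q ^ e)) huv
  rwa [map_add, map_mul, map_mul, AdjoinRoot.mk_self, mul_zero, zero_add,
      AdjoinRoot.mk_X, map_one, mul_comm] at this

/-- A `p`-th root of the class of `X` exists modulo `q ^ e` if it exists modulo `q`. In the only
case where it may fail to exist modulo `q`, namely `q = X - a`, it is assumed. -/
theorem exists_pow_eq_root_pow {p : ℕ} (hp : p ≠ 0) {q : ℝ[X]} (hq : Irreducible q)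
    (hm : q.Monic) (hX : q ≠ X) (h : ∀ a : ℝ, q = X - C a → ∃ b : ℝ, b ^ p = a) (e : ℕ) :
    ∃ y, y ^ p = AdjoinRoot.root (q ^ e) := by
  obtain ⟨y, hy⟩ := exists_pow_eq_root_of_irreducible hp hq hm h
  obtain ⟨g, rfl⟩ := AdjoinRoot.mk_surjective y
  rw [← AdjoinRoot.mk_X, ← map_pow, AdjoinRoot.mk_eq_mk] at hy
  refine exists_pow_eq_of_isNilpotent_sub hp (isUnit_root_pow hq hm hX e)
    (y := AdjoinRoot.mk _ g) ⟨e, ?_⟩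
  rw [← AdjoinRoot.mk_X, ← map_pow, ← map_sub, ← map_pow, AdjoinRoot.mk_eq_zero]
  exact pow_dvd_pow_of_dvd hy e

/-- A `p`-th root of `-1` in `ℂ` is a real `2 × 2` matrix; copies of it are placed along the
diagonal. -/
theorem Matrix.exists_pow_eq_neg_one {κ : Type*} [Fintype κ] [DecidableEq κ]
    (R : Type*) [CommRing R] [Algebra ℝ R] (hκ : Even (Fintype.card κ)) {p : ℕ} (hp : p ≠ 0) :
    ∃ M : Matrix κ κ R, M ^ p = -1 := by
  obtain ⟨m, hm⟩ := hκ
  obtain ⟨σ⟩ : Nonempty (Fin 2 × Fin m ≃ κ) := by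
    rw [← Fintype.card_eq]
    simp [hm, two_mul]
  obtain ⟨z, hz⟩ := IsAlgClosed.exists_pow_nat_eq (-1 : ℂ) (Nat.pos_of_ne_zero hp)
  let F : Matrix (Fin 2) (Fin 2) ℝ := Algebra.leftMulMatrix Complex.basisOneI z
  have hF : F ^ p = -1 := by
    rw [← map_pow, hz, map_neg, map_one]
  refine ⟨(algebraMap ℝ R).mapMatrix
    (Matrix.reindexAlgEquiv ℝ ℝ σ (Matrix.blockDiagonal fun _ : Fin m => F)), ?_⟩
  rw [← map_pow, ← map_pow, ← Matrix.blockDiagonal_pow]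
  have : (fun _ : Fin m => F) ^ p = -1 := by
    funext i
    exact hF
  rw [this, Matrix.blockDiagonal_neg, Matrix.blockDiagonal_one, map_neg, map_neg, map_one, map_one]

/-- An even number of equal blocks with a negative eigenvalue has a `p`-th root for every `p ≠ 0`. -/
theorem exists_pow_eq_mulLeft_neg {p : ℕ} (hp : p ≠ 0) {κ : Type*} [Fintype κ]
    (hκ : Even (Fintype.card κ)) {a : ℝ} (ha : a < 0) (k : ℕ) :
    ∃ y : Module.End ℝ (κ → AdjoinRoot ((X - C a : ℝ[X]) ^ k)),
      y ^ p = LinearMap.mulLeft ℝ (fun _ : κ => AdjoinRoot.root ((X - C a : ℝ[X]) ^ k)) := by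
  classical
  set R := AdjoinRoot ((X - C a : ℝ[X]) ^ k) with hR
  set x : R := AdjoinRoot.root ((X - C a) ^ k) with hx
  have hu : IsUnit x := isUnit_root_pow (irreducible_X_sub_C a) (monic_X_sub_C a)
    (fun h => ha.ne (by simpa using congrArg (eval 0) h)) k
  obtain ⟨s, hs⟩ : ∃ s : R, s ^ p = -x := by
    refine exists_pow_eq_of_isNilpotent_sub hp hu.neg
      (y := algebraMap ℝ R ((-a) ^ ((p : ℝ)⁻¹))) ⟨k, ?_⟩
    rw [← map_pow, Real.rpow_inv_natCast_pow (by linarith) hp, sub_neg_eq_add, map_neg,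
      neg_add_eq_sub]
    have := AdjoinRoot.mk_self (f := (X - C a : ℝ[X]) ^ k)
    rwa [map_pow, map_sub, AdjoinRoot.mk_X, AdjoinRoot.mk_C] at this
  obtain ⟨M, hM⟩ := Matrix.exists_pow_eq_neg_one R hκ hp
  refine ⟨(Matrix.toLin' (s • M)).restrictScalars ℝ, ?_⟩
  have h1 : ∀ (N : Matrix κ κ R) (j : ℕ), ((Matrix.toLin' N).restrictScalars ℝ) ^ j =
      (Matrix.toLin' (N ^ j)).restrictScalars ℝ := by
    intro N j
    induction j with
    | zero => ext; simp
    | succ j ih =>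
      rw [pow_succ, ih, pow_succ, Matrix.toLin'_mul]
      rfl
  rw [h1, _root_.smul_pow, hs, hM, smul_neg, neg_smul, neg_neg]
  ext v i
  simp

/-! ### Roots of nilpotent endomorphisms -/

/-- The `p`-th root of the shift `(l, i) ↦ (l, i + 1)` on `ℕ × ℕ` that moves `l` forward inside its
group `{p m, …, p m + p - 1}` and, from the end of the group, returns to its start and raises `i`. -/
def stairStep (p : ℕ) (x : ℕ × ℕ) : ℕ × ℕ :=
  if (x.1 + 1) % p = 0 then (x.1 + 1 - p, x.2 + 1) else (x.1 + 1, x.2)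

theorem stairStep_iterate {p : ℕ} (hp : 0 < p) (x : ℕ × ℕ) :
    (stairStep p)^[p] x = (x.1, x.2 + 1) := by
  obtain ⟨l, i⟩ := x
  have h1 : ∀ s, l % p + s < p → (stairStep p)^[s] (l, i) = (l + s, i) := by
    intro s
    induction s with
    | zero => simp
    | succ s ih =>
      intro hs
      rw [Function.iterate_succ_apply', ih (by omega), stairStep, if_neg]
      · rfl
      · have : (l + s + 1) % p = l % p + (s + 1) := by
          rw [add_assoc, Nat.add_mod, Nat.mod_eq_of_lt (a := s + 1) (by omega),
            Nat.mod_eq_of_lt (by omega)]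
        simp only [this]
        omega
  have hl := Nat.mod_lt l hp
  have hle := Nat.mod_le l p
  -- the walk from `l` back to the start of its group
  have h2 : (stairStep p)^[p - l % p] (l, i) = (l - l % p, i + 1) := by
    obtain ⟨s, hs⟩ : ∃ s, p - l % p = s + 1 := ⟨p - l % p - 1, by omega⟩
    rw [hs, Function.iterate_succ_apply', h1 s (by omega), stairStep, if_pos]
    · ext <;> simp; omega
    · have h3 := Nat.div_add_mod l p
      have : l + s + 1 = p * (l / p + 1) := by rw [mul_add]; omega
      simp only [this, Nat.mul_mod_right]
  -- the walk from the start of the group up to `l` again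
  have h3 : ∀ s, s < p → (stairStep p)^[s] (l - l % p, i + 1) = (l - l % p + s, i + 1) := by
    intro s
    induction s with
    | zero => simp
    | succ s ih =>
      intro hs
      rw [Function.iterate_succ_apply', ih (by omega), stairStep, if_neg]
      · rfl
      · have h4 := Nat.div_add_mod l p
        have : l - l % p + s + 1 = p * (l / p) + (s + 1) := by omega
        simp only [this, Nat.mul_add_mod, Nat.mod_eq_of_lt hs]
        omega
  have h4 : (stairStep p)^[l % p + (p - l % p)] (l, i) = (l, i + 1) := by
    rw [Function.iterate_add_apply, h2, h3 _ hl]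
    ext <;> simp; omega
  rwa [Nat.add_sub_cancel' hl.le] at h4

/-- The case of sorted sizes `lam 0 ≥ lam 1 ≥ …` (extended by `0`) such that the sizes within each
group of `p` consecutive indices differ by at most `1`. Precomposition with `stairStep p` then
preserves the functions on `ℕ × ℕ` that vanish at all `(l, i)` with `lam l ≤ i`. -/
theorem exists_pow_eq_mulLeft_sorted {K : Type*} [Field K] {p m : ℕ} (hp : 0 < p)
    (e : Fin m → ℕ) (lam : ℕ → ℕ) (hlam : ∀ l : Fin m, lam l = e l) (hlam0 : ∀ l, m ≤ l → lam l = 0)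
    (hanti : Antitone lam) (h : ∀ l, p ∣ l + 1 → lam (l + 1 - p) ≤ lam l + 1) :
    ∃ y : Module.End K (∀ l, AdjoinRoot ((X : K[X]) ^ e l)),
      y ^ p = LinearMap.mulLeft K (fun l => AdjoinRoot.root ((X : K[X]) ^ e l)) := by
  have hφ : ∀ l, ∃ φ : (Fin (e l) → K) ≃ₗ[K] AdjoinRoot ((X : K[X]) ^ e l),
      ∀ c, φ ((jordanBlock (e l) 0).mulVec c) = AdjoinRoot.root _ * φ c := by
    intro l
    have := exists_equiv_jordanBlock (0 : K) (e l)
    rwa [C_0, sub_zero] at this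
  choose φ hφ using hφ
  let T : (∀ l, AdjoinRoot ((X : K[X]) ^ e l)) →ₗ[K] (ℕ × ℕ → K) :=
    { toFun := fun v x => if h : x.1 < m then
        if h' : x.2 < e ⟨x.1, h⟩ then (φ ⟨x.1, h⟩).symm (v ⟨x.1, h⟩) ⟨x.2, h'⟩ else 0 else 0
      map_add' := fun v w => by
        funext x
        simp only [Pi.add_apply, map_add]
        split_ifs <;> simp
      map_smul' := fun a v => by
        funext x
        simp only [Pi.smul_apply, map_smul, RingHom.id_apply]
        split_ifs <;> simp }
  have hTpos : ∀ v (l : Fin m) (i : Fin (e l)), T v (l, i) = (φ l).symm (v l) i := by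
    intro v l i
    simp [T]
  have hTneg : ∀ v l i, lam l ≤ i → T v (l, i) = 0 := by
    intro v l i hi
    simp only [T, LinearMap.coe_mk, AddHom.coe_mk]
    split_ifs with h1 h2
    · have := hlam ⟨l, h1⟩
      simp only at this
      omega
    · rfl
    · rfl
  have hinj : Function.Injective T := by
    intro v w hvw
    funext l
    apply (φ l).symm.injective
    funext i
    rw [← hTpos, ← hTpos, hvw]
  have hrange : ∀ u : ℕ × ℕ → K, (∀ l i, lam l ≤ i → u (l, i) = 0) → u ∈ LinearMap.range T := by
    intro u hu
    refine ⟨fun l => φ l fun i => u (l, i), ?_⟩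
    funext ⟨l, i⟩
    by_cases hi : lam l ≤ i
    · rw [hu l i hi, hTneg _ _ _ hi]
    · have hl : l < m := by
        by_contra hl
        rw [hlam0 l (by omega)] at hi
        omega
      have hi' : i < e ⟨l, hl⟩ := by
        rw [← hlam]
        simpa using hi
      exact (hTpos _ ⟨l, hl⟩ ⟨i, hi'⟩).trans (by simp)
  have hpow : ∀ (k : ℕ) (u : ℕ × ℕ → K),
      (LinearMap.funLeft K K (stairStep p) ^ k) u = fun x => u ((stairStep p)^[k] x) := by
    intro k
    induction k with
    | zero => intro u; rfl
    | succ k ih =>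
      intro u
      rw [pow_succ, Module.End.mul_apply, ih]
      funext x
      rw [Function.iterate_succ_apply']
      rfl
  refine exists_pow_eq_of_injective T hinj (LinearMap.funLeft K K (stairStep p)) (fun v => ?_)
    fun v => hrange _ fun l i hi => ?_
  · funext ⟨l, i⟩
    simp only [hpow, stairStep_iterate hp]
    by_cases hi : lam l ≤ i
    · rw [hTneg _ _ _ hi]
      exact hTneg _ _ _ (by omega)
    · have hl : l < m := by
        by_contra hl
        rw [hlam0 l (by omega)] at hi
        omega
      have hi' : i < e ⟨l, hl⟩ := by
        rw [← hlam]
        simpa using hi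
      have h1 : (φ ⟨l, hl⟩).symm
          (LinearMap.mulLeft K (fun l => AdjoinRoot.root ((X : K[X]) ^ e l)) v ⟨l, hl⟩) =
          (jordanBlock (e ⟨l, hl⟩) 0).mulVec ((φ ⟨l, hl⟩).symm (v ⟨l, hl⟩)) := by
        apply (φ ⟨l, hl⟩).injective
        rw [hφ, LinearEquiv.apply_symm_apply, LinearEquiv.apply_symm_apply]
        rfl
      have h2 := hTpos (LinearMap.mulLeft K (fun l => AdjoinRoot.root ((X : K[X]) ^ e l)) v)
        ⟨l, hl⟩ ⟨i, hi'⟩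
      rw [h1, jordanBlock_mulVec_apply, zero_mul, zero_add] at h2
      refine Eq.trans ?_ h2.symm
      split_ifs with h3
      · exact hTpos v ⟨l, hl⟩ ⟨i + 1, h3⟩
      · refine hTneg _ _ _ ?_
        have := hlam ⟨l, hl⟩
        simp only at this h3
        simp only [this]
        omega
  · change T v (stairStep p (l, i)) = 0
    unfold stairStep
    split_ifs with h1
    · have := h l (Nat.dvd_of_mod_eq_zero h1)
      exact hTneg _ _ _ (by simp only; omega)
    · exact hTneg _ _ _ ((hanti (Nat.le_succ l)).trans hi)

/-- A nilpotent endomorphism has a `p`-th root if, for each `ν`, at most one of the numbers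
`d i` of blocks of size at least `i`, for `i ≥ 1`, lies strictly between `p ν` and `p (ν + 1)`. -/
theorem exists_pow_eq_mulLeft_nilpotent {K κ : Type*} [Field K] [Fintype κ] {p : ℕ} (hp : 0 < p)
    (e : κ → ℕ)
    (h : ∀ ν : ℕ, Set.Subsingleton {i : ℕ | 1 ≤ i ∧ p * ν < Fintype.card {j // i ≤ e j} ∧
      Fintype.card {j // i ≤ e j} < p * (ν + 1)}) :
    ∃ y : Module.End K (∀ j, AdjoinRoot ((X : K[X]) ^ e j)),
      y ^ p = LinearMap.mulLeft K (fun j => AdjoinRoot.root ((X : K[X]) ^ e j)) := by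
  classical
  set m := Fintype.card κ
  obtain ⟨σ, hσ⟩ : ∃ σ : Fin m ≃ κ, Antitone (e ∘ σ) := by
    let τ := (Fintype.equivFin κ).symm
    let f : Fin m → ℕᵒᵈ := fun l => OrderDual.toDual (e (τ l))
    exact ⟨(Tuple.sort f).trans τ, fun a b hab => Tuple.monotone_sort f hab⟩
  let lam : ℕ → ℕ := fun l => if h : l < m then e (σ ⟨l, h⟩) else 0
  have hanti : Antitone lam := by
    intro a b hab
    simp only [lam]
    split_ifs with h1 h2
    · exact hσ hab
    · omega
    · omega
    · omega
  -- as the sizes are sorted, the indices of the blocks of size at least `k` are an initial segment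
  have hcard : ∀ k l, 1 ≤ k → (l < Fintype.card {j // k ≤ e j} ↔ k ≤ lam l) := by
    intro k l hk
    have h1 : Fintype.card {j // k ≤ e j} = (Finset.univ.filter fun l => k ≤ (e ∘ σ) l).card := by
      rw [← Fintype.card_subtype]
      exact Fintype.card_congr (σ.subtypeEquiv fun _ => Iff.rfl).symm
    rw [h1]
    by_cases hl : l < m
    · have := Tuple.lt_card_ge_iff_apply_ge_of_antitone (j := ⟨l, hl⟩) (a := k) hσ
      simpa [lam, hl] using this
    · simp only [lam, hl, dite_false]
      have : (Finset.univ.filter fun l => k ≤ (e ∘ σ) l).card ≤ m := by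
        simpa using Finset.card_filter_le (Finset.univ : Finset (Fin m)) fun l => k ≤ (e ∘ σ) l
      omega
  have hkey : ∀ l, p ∣ l + 1 → lam (l + 1 - p) ≤ lam l + 1 := by
    rintro l ⟨c, hc⟩
    by_contra hlt
    obtain ⟨ν, rfl⟩ : ∃ ν, c = ν + 1 := by
      cases c with
      | zero => omega
      | succ ν => exact ⟨ν, rfl⟩
    have h0 : l + 1 - p = p * ν := by rw [hc, mul_add]; omega
    rw [h0] at hlt
    -- if the sizes in the group `ν` differ by two or more, then both `lam l + 1` and `lam l + 2` are
    -- indices of terms strictly between `p ν` and `p (ν + 1)`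
    have hmem : ∀ k, lam l + 1 ≤ k → k ≤ lam l + 2 → k ∈ {i : ℕ | 1 ≤ i ∧
        p * ν < Fintype.card {j // i ≤ e j} ∧ Fintype.card {j // i ≤ e j} < p * (ν + 1)} := by
      intro k hk1 hk2
      refine ⟨by omega, (hcard _ _ (by omega)).2 (by omega), ?_⟩
      have := (hcard k l (by omega)).not.2 (by omega)
      omega
    have := h ν (hmem (lam l + 1) le_rfl (by omega)) (hmem (lam l + 2) (by omega) le_rfl)
    omega
  refine exists_pow_eq_of_equiv
    (LinearEquiv.piCongrLeft' K (fun j => AdjoinRoot ((X : K[X]) ^ e j)) σ.symm) (fun v => ?_)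
    (exists_pow_eq_mulLeft_sorted (K := K) hp (fun l => e (σ l)) lam (fun l => by simp [lam])
      (fun l hl => by simp [lam, hl]) hanti hkey)
  rfl

/-! ### Sufficiency of the conditions -/

theorem Real.exists_pow_eq_of_nonneg_or_odd {p : ℕ} (hp : p ≠ 0) {a : ℝ} (h : 0 ≤ a ∨ Odd p) :
    ∃ b : ℝ, b ^ p = a := by
  by_cases ha : 0 ≤ a
  · exact ⟨_, Real.rpow_inv_natCast_pow ha hp⟩
  · refine ⟨-((-a) ^ ((p : ℝ)⁻¹)), ?_⟩
    rw [(h.resolve_left ha).neg_pow, Real.rpow_inv_natCast_pow (by linarith) hp, neg_neg]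

theorem exists_pow_eq_of_ascentCondition {n p : ℕ} (hp : 1 < p) {A : Matrix (Fin n) (Fin n) ℝ}
    (h1 : AscentCondition p A) (h2 : Even p → EvenNegativeBlocks A) :
    ∃ B : Matrix (Fin n) (Fin n) ℝ, B ^ p = A := by
  classical
  have hp0 : p ≠ 0 := by omega
  obtain ⟨ι, _, q, e, Φ, hq, hm, he, hΦ⟩ := exists_equiv_pi_adjoinRoot (Matrix.toLin' A)
  suffices ∃ y : Module.End ℝ (∀ i, AdjoinRoot (q i ^ e i)),
      y ^ p = LinearMap.mulLeft ℝ fun i => AdjoinRoot.root (q i ^ e i) by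
    obtain ⟨y, hy⟩ := exists_pow_eq_of_equiv Φ hΦ this
    refine ⟨LinearMap.toMatrix' y, Matrix.toLin'.injective ?_⟩
    rw [Matrix.toLin'_pow, Matrix.toLin'_toMatrix', hy]
  -- all nilpotent factors form one group; other factors are grouped by their isomorphism type
  let c : ι → Option (ℝ[X] × ℕ) := fun i => if q i = X then none else some (q i, e i)
  have hc0 : ∀ i, c i = none ↔ q i = X := fun i => by simp [c]
  have hc1 : ∀ i r k, c i = some (r, k) ↔ q i ≠ X ∧ q i = r ∧ e i = k := fun i r k => by simp [c]
  refine exists_pow_eq_mulLeft_of_fibers c _ ?_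
  rintro (_ | ⟨r, k⟩)
  -- the primes of the group are abstracted to a function `q'`, so that they can be replaced by `X`
  · have hsub : ∀ q' : {i // c i = none} → ℝ[X], (∀ j, q' j = X) →
        ∃ y : Module.End ℝ (∀ j, AdjoinRoot (q' j ^ e j)),
          y ^ p = LinearMap.mulLeft ℝ fun j => AdjoinRoot.root (q' j ^ e j) := by
      intro q' hq'
      obtain rfl : q' = fun _ => X := funext hq'
      refine exists_pow_eq_mulLeft_nilpotent (by omega) (fun j : {i // c i = none} => e j)
        fun ν i hi j hj => ?_
      have hasc : ∀ i, 1 ≤ i →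
          ascentSeq A i = Fintype.card {j : {i // c i = none} // i ≤ e j} := by
        intro i hi
        obtain ⟨i, rfl⟩ := Nat.exists_eq_add_of_le' hi
        rw [ascentSeq, nullity_pow_eq_sum hq hm Φ hΦ, nullity_pow_eq_sum hq hm Φ hΦ,
          Nat.add_sub_cancel, sum_min_succ, Finset.filter_filter, ← Fintype.card_subtype,
          Nat.cast_add, add_sub_cancel_left, Nat.cast_inj]
        exact Fintype.card_congr ((Equiv.subtypeEquivRight fun j => by rw [hc0]).trans
          (Equiv.subtypeSubtypeEquivSubtypeInter (fun j => c j = none) fun j => i + 1 ≤ e j).symm)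
      refine h1 ν ⟨hi.1, ?_⟩ ⟨hj.1, ?_⟩
      · rw [hasc i hi.1]
        exact_mod_cast hi.2
      · rw [hasc j hj.1]
        exact_mod_cast hj.2
    exact hsub (fun j => q j) fun j => (hc0 _).1 j.2
  · by_cases hneg : Even p ∧ ∃ a : ℝ, a < 0 ∧ r = X - C a
    · obtain ⟨hpe, a, ha, rfl⟩ := hneg
      have hX : (X - C a : ℝ[X]) ≠ X := fun h => ha.ne (by simpa using congrArg (eval 0) h)
      have hcard : Even (Fintype.card {i // c i = some (X - C a, k)}) := by
        rw [Fintype.card_subtype]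
        have h3 : (Finset.univ.filter fun i => c i = some (X - C a, k)) =
            (Finset.univ.filter fun i => q i = X - C a).filter fun i => e i = k := by
          rw [Finset.filter_filter]
          refine Finset.filter_congr fun i _ => ?_
          rw [hc1]
          exact ⟨fun h => h.2, fun h => ⟨h.1 ▸ hX, h⟩⟩
        rw [h3]
        cases k with
        | zero =>
          rw [Finset.filter_eq_empty_iff.2 fun i _ => (he i).ne']
          simp
        | succ k =>
          refine even_card_of_even_sum_min _ _ (fun k => ?_) k
          rw [← finrank_ker_sub_pow hq hm Φ hΦ, ← nullity_sub_scalar_pow]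
          exact (h2 hpe).even_nullity ha k
      have hsub : ∀ (q' : {i // c i = some (X - C a, k)} → ℝ[X])
          (e' : {i // c i = some (X - C a, k)} → ℕ), (∀ j, q' j = X - C a) → (∀ j, e' j = k) →
          ∃ y : Module.End ℝ (∀ j, AdjoinRoot (q' j ^ e' j)),
            y ^ p = LinearMap.mulLeft ℝ fun j => AdjoinRoot.root (q' j ^ e' j) := by
        intro q' e' hq' he'
        obtain rfl : q' = fun _ => X - C a := funext hq'
        obtain rfl : e' = fun _ => k := funext he'
        exact exists_pow_eq_mulLeft_neg hp0 hcard ha k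
      exact hsub (fun j => q j) (fun j => e j) (fun j => ((hc1 _ _ _).1 j.2).2.1)
        fun j => ((hc1 _ _ _).1 j.2).2.2
    · have hroot : ∀ j : {i // c i = some (r, k)}, ∃ y, y ^ p = AdjoinRoot.root (q j ^ e j) := by
        intro j
        obtain ⟨hX, hr, -⟩ := (hc1 _ _ _).1 j.2
        refine exists_pow_eq_root_pow hp0 (hq j) (hm j) hX (fun a ha => ?_) (e j)
        refine Real.exists_pow_eq_of_nonneg_or_odd hp0 ?_
        by_contra! hcon
        exact hneg ⟨Nat.not_odd_iff_even.1 hcon.2, a, hcon.1, hr ▸ ha⟩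
      choose y hy using hroot
      refine ⟨LinearMap.mulLeft ℝ y, ?_⟩
      rw [LinearMap.pow_mulLeft]
      congr 1
      exact funext hy

end

theorem theorem2p6 (n p : ℕ) (hp : 1 < p) (A : Matrix (Fin n) (Fin n) ℝ) :
    (∃ X : Matrix (Fin n) (Fin n) ℝ, X ^ p = A) ↔
      AscentCondition p A ∧ (Even p → EvenNegativeBlocks A) := by
  refine ⟨?_, fun h => exists_pow_eq_of_ascentCondition hp h.1 h.2⟩
  rintro ⟨B, rfl⟩
  exact ⟨ascentCondition_pow B p, fun he => evenNegativeBlocks_pow he B⟩
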